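/- For a sequence $r=(r_n)_{n\ge 0}$ of positive reals strictly decreasing to $0$ with $r_{n+1}\le\frac12 r_n$ for all $n$, let $\mathsf C(r)\subseteq\mathbb R$ denote the symmetric Cantor set defined as follows: $I_\emptyset=[0,r_0]$; if $p$ is a binary word of length $n$ and the closed interval $I_p$ of length $r_n$ has been defined, then $I_{p0}$ and $I_{p1}$ are the closed intervals of length $r_{n+1}$ such that $I_{p0}$ has the same left endpoint as $I_p$ and $I_{p1}$ has the same right endpoint as $I_p$; and $\mathsf C(r)=\bigcap_{n\ge 0}\bigcup\{I_p : p\in\{0,1\}^n\}$. Let $\mathcal{CS}$ be the family of all sets $\mathsf C(r)$ of this form. For $f:\{0,1,2,\dots\}\to[1,\infty)$ let $$\mathcal M(f)=\{\mathsf C(r)\in\mathcal{CS} : \text{for every } \varepsilon>0 \text{ there are infinitely many } n \text{ with } r_n<\varepsilon^{f(n)}\}.$$ A set $A\subseteq\mathbb R$ is microscopic if for every $\varepsilon>0$ there is a countable cover $E_1,E_2,\dots$ of $A$ with $\operatorname{diam}E_n<\varepsilon^n$ for all $n\ge1$. Then $$\mathcal M(2^n)\subsetneq\{A\in\mathcal{CS}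 : A \text{ is microscopic}\}\subsetneq\bigcap_{1<p<2}\mathcal M(p^n),$$ where $p$ ranges over the real numbers in $(1,2)$. -/

import Mathlib

open Filter Topology

namespace CantorMicro

/-- The sequences `r` that induce a symmetric Cantor set: sequences of positive reals that strictly
decrease to `0` and satisfy `r (n + 1) ≤ r n / 2` for all `n`. -/
structure IsAdmissible (r : ℕ → ℝ) : Prop where
  pos : ∀ n, 0 < r n
  strictAnti : StrictAnti r
  tendsto_zero : Tendsto r atTop (𝓝 0)
  le_half : ∀ n, r (n + 1) ≤ r n / 2

/-- The left endpoint of the interval `I_p`, for a binary word `p` of length `n`. The interval of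
the empty word starts at `0`; `I_{p0}` shares its left endpoint with `I_p`, and `I_{p1}`, which has
length `r (n + 1)`, shares its right endpoint with `I_p`, which has length `r n`. -/
noncomputable def leftEnd (r : ℕ → ℝ) : (n : ℕ) → (Fin n → Bool) → ℝ
  | 0, _ => 0
  | n + 1, p =>
      leftEnd r n (Fin.init p) + (if p (Fin.last n) = true then r n - r (n + 1) else 0)

/-- The closed interval `I_p` of length `r n`, for a binary word `p` of length `n`. -/
noncomputable def cantorInterval (r : ℕ → ℝ) (n : ℕ) (p : Fin n → Bool) : Set ℝ :=
  Set.Icc (leftEnd r n p) (leftEnd r n p + r n)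

/-- The symmetric Cantor set `C(r) = ⋂ n, ⋃ {I_p : p a binary word of length n}`. -/
noncomputable def symmCantor (r : ℕ → ℝ) : Set ℝ :=
  ⋂ n : ℕ, ⋃ p : Fin n → Bool, cantorInterval r n p

/-- The family `CS` of all symmetric Cantor sets. -/
def CS : Set (Set ℝ) :=
  {C | ∃ r : ℕ → ℝ, IsAdmissible r ∧ C = symmCantor r}

/-- The family `M(f)` of all `C(r)` such that for every `ε > 0` there are infinitely many `n` with
`r n < ε ^ f n`. -/
def M (f : ℕ → ℝ) : Set (Set ℝ) :=
  {C | ∃ r : ℕ → ℝ, IsAdmissible r ∧ C = symmCantor r ∧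
    ∀ ε : ℝ, 0 < ε → ∃ᶠ n in atTop, r n < ε ^ f n}

/-- A set of reals is microscopic if for every `ε > 0` it has a countable cover `E_1, E_2, …` with
`diam E_n < ε ^ n` for all `n ≥ 1`; here `E n` is the set `E_{n+1}`. The diameter is the
extended one, so that unbounded sets have infinite diameter. -/
def IsMicroscopic (A : Set ℝ) : Prop :=
  ∀ ε : ℝ, 0 < ε → ∃ E : ℕ → Set ℝ,
    A ⊆ ⋃ n, E n ∧ ∀ n, Metric.ediam (E n) < ENNReal.ofReal (ε ^ (n + 1))

end CantorMicro

/-!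
The Cantor set `C(r)` is microscopic exactly when `∑ log (r n) / 2 ^ n` diverges. To see this, let
`d k` be the first level at which the intervals `I_p` are shorter than `ε ^ (k + 1)`. A set of
diameter less than `ε ^ (k + 1)` meets boundedly many intervals of level `d k - 1`, so the natural
measure of `C(r)` gives it mass at most a constant times `2 ^ (-d k)`; conversely, choosing words of
length `d k` greedily produces a cover as soon as `∑ 2 ^ (-d k) > 1`. Summation by parts turns
`∑ 2 ^ (-d k)` into a sum over levels, equal up to a bounded error to
`∑ 2 ^ (-n - 1) log (r n) / log ε`.

Given the criterion, `log (r n) / 2 ^ n = -1` and `log (r n) / 2 ^ n ≈ -1 / n ^ 2` define the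
separating examples.
-/

namespace CantorMicro

open MeasureTheory

open scoped ENNReal

variable {r : ℕ → ℝ}

/-! ### The endpoints of the intervals -/

theorem isAdmissible_of_pos_of_le_half (pos : ∀ n, 0 < r n)
    (le_half : ∀ n, r (n + 1) ≤ r n / 2) : IsAdmissible r where
  pos := pos
  strictAnti := strictAnti_nat_of_succ_lt fun n => (le_half n).trans_lt (half_lt_self (pos n))
  tendsto_zero := by
    have le_geometric (n : ℕ) : r n ≤ (1 / 2) ^ n * r 0 :=
      le_geom (by norm_num) n fun k _ => (le_half k).trans_eq (by ring)
    have geometric_tendsto : Tendsto (fun n : ℕ => (1 / 2 : ℝ) ^ n * r 0) atTop (𝓝 0) := by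
      simpa using (tendsto_pow_atTop_nhds_zero_of_lt_one (r := (1 / 2 : ℝ))
        (by norm_num) (by norm_num)).mul_const (r 0)
    exact squeeze_zero (fun n => (pos n).le) le_geometric geometric_tendsto
  le_half := le_half

theorem leftEnd_snoc (r : ℕ → ℝ) {n : ℕ} (p : Fin n → Bool) (d : Bool) :
    leftEnd r (n + 1) (Fin.snoc p d) =
      leftEnd r n p + if d = true then r n - r (n + 1) else 0 := by
  simp [leftEnd]

theorem leftEnd_const_false (r : ℕ → ℝ) (n : ℕ) : leftEnd r n (fun _ => false) = 0 := by
  induction n with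
  | zero => rfl
  | succ n ih =>
    rw [leftEnd, if_neg Bool.false_ne_true, add_zero]
    exact ih

theorem exists_leftEnd_add_eq (r : ℕ → ℝ) {m n : ℕ} (hmn : m ≤ n) :
    ∃ p : Fin n → Bool, leftEnd r n p + r n = r m := by
  induction n, hmn using Nat.le_induction with
  | base => exact ⟨fun _ => false, by rw [leftEnd_const_false, zero_add]⟩
  | succ n _ ih =>
    obtain ⟨p, hp⟩ := ih
    refine ⟨Fin.snoc p true, ?_⟩
    rw [leftEnd_snoc, if_pos rfl]
    linarith

theorem leftEnd_eq_zero_or_le (hr : IsAdmissible r) {n : ℕ} (p : Fin n → Bool) :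
    leftEnd r n p = 0 ∨ r n ≤ leftEnd r n p := by
  induction n with
  | zero => exact Or.inl rfl
  | succ n ih =>
    have half := hr.le_half n
    have pos := hr.pos (n + 1)
    rw [leftEnd]
    split_ifs <;> rcases ih (Fin.init p) with h | h
    · right; linarith
    · right; linarith
    · left; linarith
    · right; linarith

theorem le_abs_leftEnd_sub (hr : IsAdmissible r) {n : ℕ} {p q : Fin n → Bool} (hpq : p ≠ q) :
    r n ≤ |leftEnd r n p - leftEnd r n q| := by
  induction n with
  | zero => exact absurd (Subsingleton.elim p q) hpq
  | succ n ih =>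
    have half := hr.le_half n
    have pos := hr.pos (n + 1)
    rw [leftEnd, leftEnd]
    by_cases hinit : Fin.init p = Fin.init q
    · have hlast : p (Fin.last n) ≠ q (Fin.last n) := fun hlast =>
        hpq (by rw [← Fin.snoc_init_self p, ← Fin.snoc_init_self q, hinit, hlast])
      rw [hinit, add_sub_add_left_eq_sub, le_abs]
      rcases Bool.eq_false_or_eq_true (p (Fin.last n)) with hp | hp
      · have hq : q (Fin.last n) = false := by simpa [hp] using hlast.symm
        left; simp only [hp, hq, if_true, Bool.false_eq_true, if_false]; linarith
      · have hq : q (Fin.last n) = true := by simpa [hp] using hlast.symm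
        right; simp only [hp, hq, if_true, Bool.false_eq_true, if_false]; linarith
    · rcases le_abs.1 (ih hinit) with h | h <;> rw [le_abs]
      · left; split_ifs <;> linarith
      · right; split_ifs <;> linarith

theorem cantorInterval_succ_subset (hr : Antitone r) {n : ℕ} (p : Fin (n + 1) → Bool) :
    cantorInterval r (n + 1) p ⊆ cantorInterval r n (Fin.init p) := by
  have le := hr n.le_succ
  refine Set.Icc_subset_Icc ?_ ?_ <;> rw [leftEnd] <;> split_ifs <;> linarith

theorem ediam_cantorInterval (r : ℕ → ℝ) {n : ℕ} (p : Fin n → Bool) :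
    Metric.ediam (cantorInterval r n p) = ENNReal.ofReal (r n) := by
  rw [cantorInterval, Real.ediam_Icc, add_sub_cancel_left]

/-! ### A symmetric Cantor set determines its sequence -/

theorem apply_mem_symmCantor (hr : IsAdmissible r) (m : ℕ) : r m ∈ symmCantor r := by
  refine Set.mem_iInter.2 fun n => Set.mem_iUnion.2 ?_
  rcases le_total n m with h | h
  · refine ⟨fun _ => false, ?_⟩
    rw [cantorInterval, leftEnd_const_false, zero_add]
    exact ⟨(hr.pos m).le, hr.strictAnti.antitone h⟩
  · obtain ⟨p, hp⟩ := exists_leftEnd_add_eq r h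
    exact ⟨p, by linarith [hr.pos n], hp.ge⟩

theorem isGreatest_symmCantor (hr : IsAdmissible r) : IsGreatest (symmCantor r) (r 0) := by
  refine ⟨apply_mem_symmCantor hr 0, fun x hx => ?_⟩
  obtain ⟨p, hp⟩ := Set.mem_iUnion.1 (Set.mem_iInter.1 hx 0)
  simpa [leftEnd] using hp.2

theorem isGreatest_symmCantor_inter_Iic (hr : IsAdmissible r) (n : ℕ) :
    IsGreatest (symmCantor r ∩ Set.Iic (r n / 2)) (r (n + 1)) := by
  refine ⟨⟨apply_mem_symmCantor hr _, hr.le_half n⟩, fun x ⟨hx, hx_half⟩ => ?_⟩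
  obtain ⟨p, hp⟩ := Set.mem_iUnion.1 (Set.mem_iInter.1 hx (n + 1))
  rw [cantorInterval, leftEnd, Set.mem_Icc] at hp
  rw [Set.mem_Iic] at hx_half
  have half := hr.le_half n
  have pos := hr.pos n
  rcases leftEnd_eq_zero_or_le hr (Fin.init p) with h | h <;> split_ifs at hp <;>
    linarith [hp.1, hp.2]

theorem injOn_symmCantor : Set.InjOn symmCantor {r | IsAdmissible r} := by
  intro r hr s hs heq
  funext n
  induction n with
  | zero => exact (isGreatest_symmCantor hr).unique (heq ▸ isGreatest_symmCantor hs)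
  | succ n ih =>
    have greatest := isGreatest_symmCantor_inter_Iic hs n
    rw [← heq, ← ih] at greatest
    exact (isGreatest_symmCantor_inter_Iic hr n).unique greatest

theorem symmCantor_mem_M_iff (hr : IsAdmissible r) (f : ℕ → ℝ) :
    symmCantor r ∈ M f ↔ ∀ ε : ℝ, 0 < ε → ∃ᶠ n in atTop, r n < ε ^ f n := by
  refine ⟨?_, fun h => ⟨r, hr, rfl, h⟩⟩
  rintro ⟨s, hs, heq, h⟩
  rwa [injOn_symmCantor hr hs heq]

/-! ### Branches of the binary tree -/

/-- The word formed by the first `n` digits of the infinite binary sequence `b`. It translates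
between branches of the binary tree and the words `p` that index the intervals `I_p`. -/
def initialWord (b : ℕ → Bool) (n : ℕ) : Fin n → Bool := fun i => b i

theorem initialWord_eq_iff_mem_cylinder {b c : ℕ → Bool} {n : ℕ} :
    initialWord b n = initialWord c n ↔ b ∈ PiNat.cylinder c n := by
  rw [PiNat.mem_cylinder_iff, funext_iff, Fin.forall_iff]
  rfl

theorem initialWord_surjective (n : ℕ) : Function.Surjective fun b => initialWord b n := fun p =>
  ⟨fun i => if h : i < n then p ⟨i, h⟩ else false, by ext i; simp [initialWord]⟩

theorem continuous_initialWord (n : ℕ) : Continuous fun b => initialWord b n :=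
  continuous_pi fun i => continuous_apply (i : ℕ)

theorem antitone_cantorInterval_initialWord (hr : Antitone r) (b : ℕ → Bool) :
    Antitone fun n => cantorInterval r n (initialWord b n) :=
  antitone_nat_of_succ_le fun n => cantorInterval_succ_subset hr (initialWord b (n + 1))

theorem exists_forall_mem_cantorInterval (hr : IsAdmissible r) (b : ℕ → Bool) :
    ∃ x, ∀ n, x ∈ cantorInterval r n (initialWord b n) :=
  ⟨_, Set.mem_iInter.1 (ciSup_mem_iInter_Icc_of_antitone_Icc
    (antitone_cantorInterval_initialWord hr.strictAnti.antitone b)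
    fun n => le_add_of_nonneg_right (hr.pos n).le)⟩

theorem mem_symmCantor_iff (hr : Antitone r) {x : ℝ} :
    x ∈ symmCantor r ↔ ∃ b, ∀ n, x ∈ cantorInterval r n (initialWord b n) := by
  refine ⟨fun hx => ?_, fun ⟨b, hb⟩ => Set.mem_iInter.2 fun n => Set.mem_iUnion.2 ⟨_, hb n⟩⟩
  let branches (n : ℕ) : Set (ℕ → Bool) := {b | x ∈ cantorInterval r n (initialWord b n)}
  have nonempty (n : ℕ) : (branches n).Nonempty := by
    obtain ⟨p, hp⟩ := Set.mem_iUnion.1 (Set.mem_iInter.1 hx n)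
    obtain ⟨b, rfl⟩ := initialWord_surjective n p
    exact ⟨b, hp⟩
  have closed (n : ℕ) : IsClosed (branches n) :=
    (isClosed_discrete {p | x ∈ cantorInterval r n p}).preimage (continuous_initialWord n)
  obtain ⟨b, hb⟩ := IsCompact.nonempty_iInter_of_sequence_nonempty_isCompact_isClosed branches
    (fun n b hb => antitone_cantorInterval_initialWord hr b n.le_succ hb) nonempty
    (closed 0).isCompact closed
  have mem_branches : ∀ n, b ∈ branches n := Set.mem_iInter.1 hb
  exact ⟨b, mem_branches⟩

/-- The distribution of an infinite sequence of independent fair coin tosses. Its image under the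
coding of `C(r)` by branches is the natural measure of `C(r)`. -/
noncomputable def coinMeasure : Measure (ℕ → Bool) :=
  Measure.infinitePi fun _ => (PMF.uniformOfFintype Bool).toMeasure

instance : IsProbabilityMeasure coinMeasure := by
  unfold coinMeasure
  infer_instance

theorem coinMeasure_cylinder (b : ℕ → Bool) (n : ℕ) :
    coinMeasure (PiNat.cylinder b n) = 2⁻¹ ^ n := by
  rw [PiNat.cylinder_eq_pi, coinMeasure,
    Measure.infinitePi_pi _ fun _ _ => measurableSet_singleton _]
  simp

/-- A greedy choice of branches: the `k`-th one avoids the cylinders of lengths `N 0, …, N (k - 1)`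
around its predecessors, and is arbitrary once these cylinders cover everything. -/
noncomputable def greedyBranch (N : ℕ → ℕ) (k : ℕ) : ℕ → Bool :=
  Classical.epsilon fun b => ∀ i : Fin k, b ∉ PiNat.cylinder (greedyBranch N i) (N i)
termination_by k
decreasing_by exact i.isLt

theorem greedyBranch_notMem_cylinder {N : ℕ → ℕ} {b : ℕ → Bool}
    (hb : ∀ k, b ∉ PiNat.cylinder (greedyBranch N k) (N k)) {i k : ℕ} (hik : i < k) :
    greedyBranch N k ∉ PiNat.cylinder (greedyBranch N i) (N i) := by
  have hspec := Classical.epsilon_spec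
    (p := fun b => ∀ i : Fin k, b ∉ PiNat.cylinder (greedyBranch N i) (N i)) ⟨b, fun i => hb i⟩
  rw [← greedyBranch] at hspec
  exact hspec ⟨i, hik⟩

/-- A converse of Kraft's inequality: if the chosen cylinders missed a branch they would be pairwise
disjoint, and their measures would add up to at most `1`. -/
theorem iUnion_cylinder_greedyBranch {N : ℕ → ℕ} (hN : Monotone N)
    (hsum : 1 < ∑' k, (2⁻¹ : ℝ≥0∞) ^ N k) :
    ⋃ k, PiNat.cylinder (greedyBranch N k) (N k) = Set.univ := by
  by_contra hne
  obtain ⟨b, hb⟩ := (Set.ne_univ_iff_exists_notMem _).1 hne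
  have avoids : ∀ k, b ∉ PiNat.cylinder (greedyBranch N k) (N k) := by simpa using hb
  have disjoint : Pairwise
      (Function.onFun Disjoint fun k => PiNat.cylinder (greedyBranch N k) (N k)) := by
    refine (pairwise_disjoint_on _).2 fun i k hik => Set.disjoint_left.2 fun c hci hck => ?_
    apply greedyBranch_notMem_cylinder avoids hik
    rw [← PiNat.mem_cylinder_iff_eq.1 hci, PiNat.mem_cylinder_comm]
    exact PiNat.cylinder_anti _ (hN hik.le) hck
  have measurable (k : ℕ) : MeasurableSet (PiNat.cylinder (greedyBranch N k) (N k)) :=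
    (PiNat.isOpen_cylinder _ _ _).measurableSet
  refine hsum.not_ge ?_
  calc ∑' k, (2⁻¹ : ℝ≥0∞) ^ N k
      = ∑' k, coinMeasure (PiNat.cylinder (greedyBranch N k) (N k)) := by
        simp only [coinMeasure_cylinder]
    _ = coinMeasure (⋃ k, PiNat.cylinder (greedyBranch N k) (N k)) :=
        (measure_iUnion disjoint measurable).symm
    _ ≤ 1 := prob_le_one

/-! ### The natural measure of small sets -/

theorem card_le_of_separated {ι : Type*} {P : Finset ι} {f : ι → ℝ} {a δ : ℝ} {m : ℕ}
    (hδ : 0 < δ) (hsep : (P : Set ι).Pairwise fun p q => δ ≤ |f p - f q|)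
    (hmem : ∀ p ∈ P, f p ∈ Set.Icc a (a + m * δ)) : P.card ≤ m + 1 := by
  rw [← Finset.card_range (m + 1)]
  refine Finset.card_le_card_of_injOn (fun p => ⌊(f p - a) / δ⌋₊) (fun p hp => ?_) ?_
  · rw [Finset.coe_range, Set.mem_Iio, Nat.lt_succ_iff]
    refine Nat.floor_le_of_le ?_
    rw [div_le_iff₀ hδ]
    linarith [(hmem p hp).2]
  · intro p hp q hq hpq
    have nonneg {p : ι} (hp : p ∈ P) : 0 ≤ (f p - a) / δ :=
      div_nonneg (sub_nonneg.2 (hmem p hp).1) hδ.le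
    have floor_eq : ⌊(f p - a) / δ⌋ = ⌊(f q - a) / δ⌋ := by
      rw [← Int.natCast_floor_eq_floor (nonneg hp), ← Int.natCast_floor_eq_floor (nonneg hq)]
      exact congrArg Nat.cast hpq
    by_contra hne
    have close := Int.abs_sub_lt_one_of_floor_eq_floor floor_eq
    rw [← sub_div, abs_div, abs_of_pos hδ, div_lt_one hδ, sub_sub_sub_cancel_right] at close
    exact (hsep hp hq hne).not_gt close

theorem coinMeasure_preimage_le (hr : IsAdmissible r) {x : (ℕ → Bool) → ℝ}
    (hx : ∀ b n, x b ∈ cantorInterval r n (initialWord b n)) (n : ℕ) {S : Set ℝ}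
    (hS : Metric.ediam S ≤ ENNReal.ofReal (r n)) : coinMeasure (x ⁻¹' S) ≤ 4 * 2⁻¹ ^ n := by
  classical
  rcases (x ⁻¹' S).eq_empty_or_nonempty with hempty | ⟨c, hc⟩
  · simp [hempty]
  choose branch hbranch using initialWord_surjective n
  let P : Finset (Fin n → Bool) := {p | ∃ b, x b ∈ S ∧ initialWord b n = p}
  have card_le : P.card ≤ 3 + 1 := by
    refine card_le_of_separated (f := leftEnd r n) (a := x c - 2 * r n) (hr.pos n)
      (fun p _ q _ hpq => le_abs_leftEnd_sub hr hpq) fun p hp => ?_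
    obtain ⟨b, hb, rfl⟩ := (Finset.mem_filter.1 hp).2
    have hdist := (Metric.edist_le_ediam_of_mem hb hc).trans hS
    rw [edist_le_ofReal (hr.pos n).le, Real.dist_eq, abs_le] at hdist
    obtain ⟨hleft, hright⟩ := hx b n
    constructor <;> push_cast <;> linarith [hdist.1, hdist.2]
  have preimage_subset : x ⁻¹' S ⊆ ⋃ p ∈ P, PiNat.cylinder (branch p) n := fun b hb =>
    Set.mem_biUnion (Finset.mem_filter.2 ⟨Finset.mem_univ _, b, hb, rfl⟩)
      (initialWord_eq_iff_mem_cylinder.1 (hbranch _).symm)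
  calc coinMeasure (x ⁻¹' S) ≤ ∑ p ∈ P, coinMeasure (PiNat.cylinder (branch p) n) :=
        (measure_mono preimage_subset).trans (measure_biUnion_finset_le _ _)
    _ = P.card * 2⁻¹ ^ n := by simp [coinMeasure_cylinder]
    _ ≤ 4 * 2⁻¹ ^ n := by gcongr; exact_mod_cast card_le

/-- The first level at which the intervals `I_p` are shorter than `t`; meaningful when `r` tends to
`0` and `0 < t`. -/
noncomputable def depth (r : ℕ → ℝ) (t : ℝ) : ℕ := sInf {n | r n < t}

theorem depth_le_iff (hr : Antitone r) (hlim : Tendsto r atTop (𝓝 0)) {t : ℝ} (ht : 0 < t)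
    {n : ℕ} : depth r t ≤ n ↔ r n < t :=
  ⟨fun h => (hr h).trans_lt (Nat.sInf_mem (hlim.eventually_lt_const ht).exists),
    fun h => Nat.sInf_le h⟩

theorem coinMeasure_preimage_le_depth (hr : IsAdmissible r) {x : (ℕ → Bool) → ℝ}
    (hx : ∀ b n, x b ∈ cantorInterval r n (initialWord b n)) {t : ℝ} (ht : 0 < t) {S : Set ℝ}
    (hS : Metric.ediam S ≤ ENNReal.ofReal t) :
    coinMeasure (x ⁻¹' S) ≤ 8 * 2⁻¹ ^ depth r t := by
  rcases hd : depth r t with _ | n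
  · exact prob_le_one.trans (by norm_num)
  · have le_apply : t ≤ r n := by
      rw [← not_lt, ← depth_le_iff hr.strictAnti.antitone hr.tendsto_zero ht]
      lia
    calc coinMeasure (x ⁻¹' S) ≤ 4 * 2⁻¹ ^ n :=
          coinMeasure_preimage_le hr hx n (hS.trans (ENNReal.ofReal_le_ofReal le_apply))
      _ = 4 * (2 * 2⁻¹) * 2⁻¹ ^ n := by
          rw [ENNReal.mul_inv_cancel two_ne_zero ENNReal.ofNat_ne_top, mul_one]
      _ = 8 * 2⁻¹ ^ (n + 1) := by ring

theorem one_le_tsum_depth_of_cover (hr : IsAdmissible r) {t : ℕ → ℝ} (ht : ∀ k, 0 < t k)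
    {E : ℕ → Set ℝ} (hcover : symmCantor r ⊆ ⋃ k, E k)
    (hE : ∀ k, Metric.ediam (E k) ≤ ENNReal.ofReal (t k)) :
    1 ≤ 8 * ∑' k, (2⁻¹ : ℝ≥0∞) ^ depth r (t k) := by
  choose x hx using exists_forall_mem_cantorInterval hr
  have preimages_cover : ⋃ k, x ⁻¹' E k = Set.univ := by
    rw [← Set.preimage_iUnion, Set.preimage_eq_univ_iff]
    rintro _ ⟨b, rfl⟩
    exact hcover ((mem_symmCantor_iff hr.strictAnti.antitone).2 ⟨b, hx b⟩)
  calc (1 : ℝ≥0∞) = coinMeasure (⋃ k, x ⁻¹' E k) := by rw [preimages_cover, measure_univ]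
    _ ≤ ∑' k, coinMeasure (x ⁻¹' E k) := measure_iUnion_le _
    _ ≤ ∑' k, 8 * 2⁻¹ ^ depth r (t k) :=
        ENNReal.tsum_le_tsum fun k => coinMeasure_preimage_le_depth hr hx (ht k) (hE k)
    _ = 8 * ∑' k, 2⁻¹ ^ depth r (t k) := ENNReal.tsum_mul_left

theorem exists_cover_of_one_lt_tsum_depth (hr : Antitone r) (hlim : Tendsto r atTop (𝓝 0))
    {t : ℕ → ℝ} (ht : ∀ k, 0 < t k) (ht_anti : Antitone t)
    (hsum : 1 < ∑' k, (2⁻¹ : ℝ≥0∞) ^ depth r (t k)) :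
    ∃ E : ℕ → Set ℝ, symmCantor r ⊆ ⋃ k, E k ∧
      ∀ k, Metric.ediam (E k) < ENNReal.ofReal (t k) := by
  have depth_lt (k : ℕ) : r (depth r (t k)) < t k := (depth_le_iff hr hlim (ht k)).1 le_rfl
  let N (k : ℕ) : ℕ := depth r (t k)
  have N_mono : Monotone N := fun i k hik =>
    (depth_le_iff hr hlim (ht i)).2 ((depth_lt k).trans_le (ht_anti hik))
  refine ⟨fun k => cantorInterval r (N k) (initialWord (greedyBranch N k) (N k)),
    fun x hx => ?_, fun k => ?_⟩
  · obtain ⟨b, hb⟩ := (mem_symmCantor_iff hr).1 hx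
    have b_covered : b ∈ ⋃ k, PiNat.cylinder (greedyBranch N k) (N k) :=
      iUnion_cylinder_greedyBranch N_mono hsum ▸ Set.mem_univ b
    obtain ⟨k, hk⟩ := Set.mem_iUnion.1 b_covered
    exact Set.mem_iUnion.2 ⟨k, initialWord_eq_iff_mem_cylinder.2 hk ▸ hb (N k)⟩
  · rw [ediam_cantorInterval]
    exact (ENNReal.ofReal_lt_ofReal_iff (ht k)).2 (depth_lt k)

/-! ### Summation over levels -/

theorem two_inv_pow_eq_tsum (N : ℕ) :
    (2⁻¹ : ℝ≥0∞) ^ N = ∑' n, if N ≤ n then 2⁻¹ ^ (n + 1) else 0 := by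
  rw [← ENNReal.summable.sum_add_tsum_nat_add' (k := N),
    Finset.sum_eq_zero fun n hn => if_neg (Finset.mem_range.1 hn).not_ge, zero_add]
  simp_rw [if_pos (Nat.le_add_left N _), add_right_comm _ N 1, pow_add _ _ N]
  rw [ENNReal.tsum_mul_right, ENNReal.tsum_geometric_add_one, ENNReal.one_sub_inv_two, inv_inv,
    ENNReal.inv_mul_cancel two_ne_zero ENNReal.ofNat_ne_top, one_mul]

theorem tsum_two_inv_pow_depth (hr : Antitone r) (hlim : Tendsto r atTop (𝓝 0)) {t : ℕ → ℝ}
    (ht : ∀ k, 0 < t k) :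
    ∑' k, (2⁻¹ : ℝ≥0∞) ^ depth r (t k) =
      ∑' n, ({k | r n < t k}.encard : ℝ≥0∞) * 2⁻¹ ^ (n + 1) :=
  calc ∑' k, (2⁻¹ : ℝ≥0∞) ^ depth r (t k)
      = ∑' k, ∑' n, if depth r (t k) ≤ n then (2⁻¹ : ℝ≥0∞) ^ (n + 1) else 0 :=
        tsum_congr fun k => two_inv_pow_eq_tsum _
    _ = ∑' n, ∑' k, if depth r (t k) ≤ n then (2⁻¹ : ℝ≥0∞) ^ (n + 1) else 0 := ENNReal.tsum_comm
    _ = ∑' n, ∑' k, {k | r n < t k}.indicator (fun _ => (2⁻¹ : ℝ≥0∞) ^ (n + 1)) k := by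
        simp only [depth_le_iff hr hlim (ht _), Set.indicator_apply, Set.mem_ofPred_eq]
    _ = _ := tsum_congr fun n => by rw [← tsum_subtype, ENNReal.tsum_set_const]

theorem encard_setOf_lt_exp_neg_pow {x L : ℝ} (hx : 0 < x) (hL : 0 < L) :
    {k : ℕ | x < Real.exp (-L) ^ (k + 1)}.encard = (⌈-Real.log x / L⌉₊ - 1 : ℕ) := by
  have eq_range :
      {k : ℕ | x < Real.exp (-L) ^ (k + 1)} = Finset.range (⌈-Real.log x / L⌉₊ - 1) := by
    ext k
    rw [Set.mem_ofPred_eq, ← Real.exp_nat_mul, ← Real.log_lt_iff_lt_exp hx, Finset.coe_range,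
      Set.mem_Iio, Nat.lt_sub_iff_add_lt, Nat.lt_ceil, lt_div_iff₀ hL, mul_neg, lt_neg]
  rw [eq_range, Set.encard_coe_eq_coe_finsetCard, Finset.card_range]

theorem natCast_ceil_sub_one_le_ofReal (y : ℝ) : ((⌈y⌉₊ - 1 : ℕ) : ℝ≥0∞) ≤ ENNReal.ofReal y := by
  rcases Nat.eq_zero_or_pos (⌈y⌉₊ - 1) with hzero | hpos
  · simp [hzero]
  · rw [ENNReal.natCast_le_ofReal hpos.ne']
    exact (Nat.lt_ceil.1 (by lia)).le

theorem ofReal_le_natCast_ceil_sub_one_add_one (y : ℝ) :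
    ENNReal.ofReal y ≤ ((⌈y⌉₊ - 1 : ℕ) : ℝ≥0∞) + 1 := by
  rw [← Nat.cast_add_one, ENNReal.ofReal_le_natCast]
  exact (Nat.le_ceil y).trans (by exact_mod_cast le_tsub_add)

/-- The sum of the positive parts of `-log (r n)`, weighted by `2 ^ (-n - 1)`: the quantity that
decides whether `C(r)` is microscopic. -/
noncomputable def logWeight (r : ℕ → ℝ) : ℝ≥0∞ :=
  ∑' n, ENNReal.ofReal (-Real.log (r n)) * 2⁻¹ ^ (n + 1)

theorem tsum_ofReal_neg_log_div (r : ℕ → ℝ) {L : ℝ} (hL : 0 < L) :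
    ∑' n, ENNReal.ofReal (-Real.log (r n) / L) * 2⁻¹ ^ (n + 1) =
      logWeight r / ENNReal.ofReal L := by
  rw [logWeight, ENNReal.div_eq_inv_mul, ← ENNReal.tsum_mul_left]
  refine tsum_congr fun n => ?_
  rw [ENNReal.ofReal_div_of_pos hL, ENNReal.div_eq_inv_mul, mul_assoc]

theorem tsum_depth_le_logWeight_div (hr : IsAdmissible r) {L : ℝ} (hL : 0 < L) :
    ∑' k : ℕ, (2⁻¹ : ℝ≥0∞) ^ depth r (Real.exp (-L) ^ (k + 1)) ≤
      logWeight r / ENNReal.ofReal L := by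
  rw [tsum_two_inv_pow_depth hr.strictAnti.antitone hr.tendsto_zero fun k => by positivity,
    ← tsum_ofReal_neg_log_div r hL]
  refine ENNReal.tsum_le_tsum fun n => ?_
  rw [encard_setOf_lt_exp_neg_pow (hr.pos n) hL]
  gcongr
  exact natCast_ceil_sub_one_le_ofReal _

theorem logWeight_div_le_tsum_depth_add_one (hr : IsAdmissible r) {L : ℝ} (hL : 0 < L) :
    logWeight r / ENNReal.ofReal L ≤
      ∑' k : ℕ, (2⁻¹ : ℝ≥0∞) ^ depth r (Real.exp (-L) ^ (k + 1)) + 1 := by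
  have tsum_weights : ∑' n : ℕ, (2⁻¹ : ℝ≥0∞) ^ (n + 1) = 1 := by
    simpa using (two_inv_pow_eq_tsum 0).symm
  rw [tsum_two_inv_pow_depth hr.strictAnti.antitone hr.tendsto_zero fun k => by positivity,
    ← tsum_ofReal_neg_log_div r hL, ← tsum_weights, ← ENNReal.tsum_add]
  refine ENNReal.tsum_le_tsum fun n => ?_
  rw [encard_setOf_lt_exp_neg_pow (hr.pos n) hL, ← add_one_mul]
  gcongr
  exact ofReal_le_natCast_ceil_sub_one_add_one _

/-! ### The criterion -/

theorem logWeight_eq_top_of_isMicroscopic (hr : IsAdmissible r)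
    (hmic : IsMicroscopic (symmCantor r)) : logWeight r = ⊤ := by
  by_contra hfin
  let L : ℝ := 8 * (logWeight r).toReal + 1
  have L_pos : 0 < L := by positivity
  obtain ⟨E, hcover, hE⟩ := hmic (Real.exp (-L)) (Real.exp_pos _)
  have one_le : 1 ≤ 8 * (logWeight r / ENNReal.ofReal L) :=
    (one_le_tsum_depth_of_cover hr (fun k => by positivity) hcover fun k => (hE k).le).trans
      (mul_le_mul_right (tsum_depth_le_logWeight_div hr L_pos) 8)
  rw [← ENNReal.ofReal_toReal hfin, ← ENNReal.ofReal_div_of_pos L_pos,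
    ← ENNReal.ofReal_ofNat 8, ← ENNReal.ofReal_mul (by norm_num), ENNReal.one_le_ofReal,
    ← mul_div_assoc, one_le_div L_pos] at one_le
  linarith

theorem isMicroscopic_of_logWeight_eq_top (hr : IsAdmissible r) (htop : logWeight r = ⊤) :
    IsMicroscopic (symmCantor r) := by
  intro ε hε
  obtain ⟨L, hL, hLε⟩ : ∃ L : ℝ, 0 < L ∧ Real.exp (-L) ≤ ε := by
    refine ⟨max 1 (-Real.log ε), by positivity, ?_⟩
    rw [← Real.le_log_iff_exp_le hε, neg_le]
    exact le_max_right _ _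
  have tsum_eq_top : ∑' k : ℕ, (2⁻¹ : ℝ≥0∞) ^ depth r (Real.exp (-L) ^ (k + 1)) = ⊤ := by
    simpa [htop, ENNReal.top_div_of_ne_top] using logWeight_div_le_tsum_depth_add_one hr hL
  have powers_anti : Antitone fun k : ℕ => Real.exp (-L) ^ (k + 1) := fun i k hik =>
    pow_le_pow_of_le_one (Real.exp_pos _).le (Real.exp_le_one_iff.2 (by linarith)) (by gcongr)
  obtain ⟨E, hcover, hE⟩ := exists_cover_of_one_lt_tsum_depth hr.strictAnti.antitone
    hr.tendsto_zero (fun k => by positivity) powers_anti (tsum_eq_top ▸ ENNReal.one_lt_top)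
  exact ⟨E, hcover, fun k => (hE k).trans_le (by gcongr)⟩

theorem tsum_ofReal_ne_top_iff_summable {ι : Type*} {f : ι → ℝ}
    (hf : ∀ᶠ i in cofinite, 0 ≤ f i) : ∑' i, ENNReal.ofReal (f i) ≠ ⊤ ↔ Summable f := by
  rw [← summable_congr_cofinite (hf.mono fun i hi => Real.coe_toNNReal (f i) hi),
    NNReal.summable_coe]
  exact ENNReal.tsum_coe_ne_top_iff_summable

theorem eventually_log_neg (hr : IsAdmissible r) : ∀ᶠ n in atTop, Real.log (r n) < 0 :=
  (hr.tendsto_zero.eventually_lt_const one_pos).mono fun n hn => Real.log_neg (hr.pos n) hn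

theorem logWeight_ne_top_iff_summable (hr : IsAdmissible r) :
    logWeight r ≠ ⊤ ↔ Summable fun n => Real.log (r n) / 2 ^ n := by
  have logWeight_eq :
      logWeight r = ∑' n, ENNReal.ofReal (Real.log (r n) / 2 ^ n * -2⁻¹) := by
    refine tsum_congr fun n => ?_
    have two_inv_pow : (2⁻¹ : ℝ≥0∞) ^ (n + 1) = ENNReal.ofReal (2⁻¹ ^ (n + 1)) := by
      rw [ENNReal.ofReal_pow (by norm_num), ENNReal.ofReal_inv_of_pos two_pos,
        ENNReal.ofReal_ofNat]
    rw [two_inv_pow, ← ENNReal.ofReal_mul' (by positivity)]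
    rw [inv_pow, pow_succ]
    congr 1
    field_simp
  rw [logWeight_eq, tsum_ofReal_ne_top_iff_summable, summable_mul_right_iff (by norm_num)]
  rw [Nat.cofinite_eq_atTop]
  filter_upwards [eventually_log_neg hr] with n hn
  exact mul_nonneg_of_nonpos_of_nonpos (div_nonpos_of_nonpos_of_nonneg hn.le (by positivity))
    (by norm_num)

theorem isMicroscopic_symmCantor_iff (hr : IsAdmissible r) :
    IsMicroscopic (symmCantor r) ↔ ¬ Summable fun n => Real.log (r n) / 2 ^ n := by
  rw [← logWeight_ne_top_iff_summable hr, not_not]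
  exact ⟨logWeight_eq_top_of_isMicroscopic hr, isMicroscopic_of_logWeight_eq_top hr⟩

theorem not_summable_of_frequently_lt (hr : ∀ n, 0 < r n)
    (hfreq : ∃ᶠ n : ℕ in atTop, r n < Real.exp (-1) ^ (2 : ℝ) ^ n) :
    ¬ Summable fun n => Real.log (r n) / 2 ^ n := by
  intro hs
  refine hfreq ((hs.tendsto_atTop_zero.eventually_const_lt neg_one_lt_zero).mono fun n hn => ?_)
  rw [not_lt, ← Real.exp_mul, ← Real.le_log_iff_exp_le (hr n)]
  exact ((lt_div_iff₀ (by positivity)).1 hn).le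

theorem summable_of_eventually_rpow_le (hr : IsAdmissible r) {p ε : ℝ} (hp : 0 ≤ p) (hp2 : p < 2)
    (hε : 0 < ε) (hle : ∀ᶠ n : ℕ in atTop, ε ^ p ^ n ≤ r n) :
    Summable fun n => Real.log (r n) / 2 ^ n := by
  have geometric : Summable fun n : ℕ => -Real.log ε * (p / 2) ^ n :=
    (summable_geometric_of_lt_one (by positivity) (by linarith)).mul_left _
  refine Summable.of_norm_bounded_eventually_nat geometric ?_
  filter_upwards [hle, eventually_log_neg hr] with n hn hlog
  have log_le : p ^ n * Real.log ε ≤ Real.log (r n) := by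
    rw [← Real.log_rpow hε]
    exact Real.log_le_log (by positivity) hn
  rw [Real.norm_eq_abs, abs_div, abs_of_neg hlog, abs_of_pos (by positivity), div_pow,
    ← mul_div_assoc]
  gcongr
  linarith

theorem M_two_pow_subset_isMicroscopic :
    M (fun n : ℕ => (2 : ℝ) ^ n) ⊆ {A | IsMicroscopic A} ∩ CS := by
  rintro _ ⟨r, hr, rfl, hfreq⟩
  refine ⟨(isMicroscopic_symmCantor_iff hr).2 ?_, r, hr, rfl⟩
  exact not_summable_of_frequently_lt hr.pos (hfreq _ (Real.exp_pos _))

theorem isMicroscopic_subset_M_pow {p : ℝ} (hp : 0 ≤ p) (hp2 : p < 2) :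
    {A | IsMicroscopic A} ∩ CS ⊆ M fun n : ℕ => p ^ n := by
  rintro _ ⟨hmic, r, hr, rfl⟩
  refine ⟨r, hr, rfl, fun ε hε hle => (isMicroscopic_symmCantor_iff hr).1 hmic ?_⟩
  exact summable_of_eventually_rpow_le hr hp hp2 hε (hle.mono fun n hn => not_lt.1 hn)

/-! ### The separating examples -/

theorem isAdmissible_exp_neg {g : ℕ → ℝ} (hg : ∀ n, g n + Real.log 2 ≤ g (n + 1)) :
    IsAdmissible fun n => Real.exp (-g n) := by
  refine isAdmissible_of_pos_of_le_half (fun n => Real.exp_pos _) fun n => ?_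
  calc Real.exp (-g (n + 1)) ≤ Real.exp (-g n - Real.log 2) := by gcongr; linarith [hg n]
    _ = Real.exp (-g n) / 2 := by rw [Real.exp_sub, Real.exp_log two_pos]

theorem isAdmissible_exp_neg_two_pow : IsAdmissible fun n : ℕ => Real.exp (-2 ^ n) := by
  refine isAdmissible_exp_neg fun n => ?_
  have one_le : (1 : ℝ) ≤ 2 ^ n := one_le_pow₀ one_le_two
  rw [pow_succ]
  linarith [Real.log_two_lt_d9]

theorem isMicroscopic_exp_neg_two_pow :
    IsMicroscopic (symmCantor fun n : ℕ => Real.exp (-2 ^ n)) := by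
  rw [isMicroscopic_symmCantor_iff isAdmissible_exp_neg_two_pow]
  simp [summable_const_iff]

theorem symmCantor_exp_neg_two_pow_notMem_M :
    symmCantor (fun n : ℕ => Real.exp (-2 ^ n)) ∉ M fun n : ℕ => (2 : ℝ) ^ n := by
  rw [symmCantor_mem_M_iff isAdmissible_exp_neg_two_pow]
  intro h
  obtain ⟨n, hn⟩ := (h (Real.exp (-1)) (Real.exp_pos _)).exists
  rw [← Real.exp_mul, neg_one_mul] at hn
  exact lt_irrefl _ hn

/-- The exponents `n + 2 ^ n / (n ^ 2 + 2)`, which outgrow `p ^ n` for every `p < 2` but have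
summable ratio to `2 ^ n`. The constant `2` makes the second term monotone, and the first term then
provides the increments that admissibility requires. -/
noncomputable def slowExponent (n : ℕ) : ℝ := n + 2 ^ n / (n ^ 2 + 2)

theorem slowExponent_add_one_le (n : ℕ) : slowExponent n + 1 ≤ slowExponent (n + 1) := by
  have ratio_mono : (2 : ℝ) ^ n / (n ^ 2 + 2) ≤ 2 ^ (n + 1) / ((n + 1 : ℕ) ^ 2 + 2) := by
    have denominators : ((n : ℝ) + 1) ^ 2 + 2 ≤ 2 * (n ^ 2 + 2) := by
      nlinarith [sq_nonneg ((n : ℝ) - 1)]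
    rw [div_le_div_iff₀ (by positivity) (by positivity), pow_succ (2 : ℝ), mul_assoc]
    push_cast
    gcongr
  rw [slowExponent, slowExponent]
  push_cast at ratio_mono ⊢
  linarith

theorem isAdmissible_exp_neg_slowExponent : IsAdmissible fun n => Real.exp (-slowExponent n) :=
  isAdmissible_exp_neg fun n => by linarith [slowExponent_add_one_le n, Real.log_two_lt_d9]

theorem summable_slowExponent_div_two_pow : Summable fun n => slowExponent n / 2 ^ n := by
  have linear_part : Summable fun n : ℕ => (n : ℝ) ^ 1 * (1 / 2) ^ n :=
    summable_pow_mul_geometric_of_norm_lt_one 1 (by norm_num)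
  have quadratic_part : Summable fun n : ℕ => 1 / ((n : ℝ) ^ 2 + 2) := by
    refine Summable.of_norm_bounded_eventually_nat
      (Real.summable_one_div_nat_pow.2 one_lt_two) ?_
    filter_upwards [eventually_gt_atTop 0] with n hn
    rw [Real.norm_of_nonneg (by positivity)]
    gcongr
    linarith
  refine (linear_part.add quadratic_part).congr fun n => ?_
  rw [slowExponent, one_div_pow]
  field_simp

theorem not_isMicroscopic_exp_neg_slowExponent :
    ¬ IsMicroscopic (symmCantor fun n => Real.exp (-slowExponent n)) := by
  rw [isMicroscopic_symmCantor_iff isAdmissible_exp_neg_slowExponent, not_not]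
  simpa only [Real.log_exp, neg_div] using summable_slowExponent_div_two_pow.neg

theorem eventually_mul_pow_lt_slowExponent {p : ℝ} (hp : 0 ≤ p) (hp2 : p < 2) (K : ℝ) :
    ∀ᶠ n in atTop, K * p ^ n < slowExponent n := by
  have limit (k : ℕ) : Tendsto (fun n : ℕ => (n : ℝ) ^ k * (p / 2) ^ n) atTop (𝓝 0) :=
    tendsto_pow_const_mul_const_pow_of_lt_one k (by positivity) (by linarith)
  have limit_sum := ((limit 2).add ((limit 0).const_mul 2)).const_mul K
  rw [mul_zero, add_zero, mul_zero] at limit_sum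
  filter_upwards [limit_sum.eventually_lt_const one_pos] with n hn
  have bound : K * p ^ n < 2 ^ n / (n ^ 2 + 2) := by
    rw [lt_div_iff₀ (by positivity)]
    calc K * p ^ n * (n ^ 2 + 2)
        = K * (n ^ 2 * (p / 2) ^ n + 2 * (n ^ 0 * (p / 2) ^ n)) * 2 ^ n := by
          rw [div_pow]; field_simp
      _ < 1 * 2 ^ n := by gcongr
      _ = 2 ^ n := one_mul _
  exact bound.trans_le (le_add_of_nonneg_left n.cast_nonneg)

theorem symmCantor_exp_neg_slowExponent_mem_M {p : ℝ} (hp : 0 ≤ p) (hp2 : p < 2) :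
    symmCantor (fun n => Real.exp (-slowExponent n)) ∈ M fun n : ℕ => p ^ n := by
  refine ⟨_, isAdmissible_exp_neg_slowExponent, rfl, fun ε hε => Eventually.frequently ?_⟩
  filter_upwards [eventually_mul_pow_lt_slowExponent hp hp2 (-Real.log ε)] with n hn
  rw [Real.rpow_def_of_pos hε, Real.exp_lt_exp]
  linarith

end CantorMicro

theorem mainTheorem12 :
    CantorMicro.M (fun n : ℕ => (2 : ℝ) ^ n) ⊂
        {A : Set ℝ | CantorMicro.IsMicroscopic A} ∩ CantorMicro.CS ∧
      {A : Set ℝ | CantorMicro.IsMicroscopic A} ∩ CantorMicro.CS ⊂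
        ⋂ p ∈ Set.Ioo (1 : ℝ) 2, CantorMicro.M (fun n : ℕ => p ^ n) := by
  refine ⟨⟨CantorMicro.M_two_pow_subset_isMicroscopic, fun h => ?_⟩,
    ⟨Set.subset_iInter₂ fun p hp => ?_, fun h => ?_⟩⟩
  · exact CantorMicro.symmCantor_exp_neg_two_pow_notMem_M
      (h ⟨CantorMicro.isMicroscopic_exp_neg_two_pow,
        _, CantorMicro.isAdmissible_exp_neg_two_pow, rfl⟩)
  · exact CantorMicro.isMicroscopic_subset_M_pow (zero_le_one.trans hp.1.le) hp.2
  · exact CantorMicro.not_isMicroscopic_exp_neg_slowExponent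
      (h (Set.mem_iInter₂.2 fun p hp =>
        CantorMicro.symmCantor_exp_neg_slowExponent_mem_M (zero_le_one.trans hp.1.le) hp.2)).1
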